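/- Let $F$ be a free semigroup (without adjoined identity) on a set of at least two free generators (possibly infinite), and let $I$ be a proper two-sided ideal of $F$, that is, $\emptyset\ne I\ne F$, $FI\subseteq I$ and $IF\subseteq I$. Then the semigroup $I$ has cohomological dimension greater than $1$. Here, for a semigroup $S$ and a left $S$-module $A$ (an abelian group with an action of $S$ by additive endomorphisms satisfying $x(ya)=(xy)a$), $H^n(S,A)$ is the $n$-th Eilenberg--MacLane cohomology group, i.e. the $n$-th cohomology group of the complex of all maps $f:S^n\to A$ ($n\ge 0$) with coboundary $$\partial^n f(x_1,\ldots,x_{n+1})=x_1f(x_2,\ldots,x_{n+1})+\sum_{i=1}^n(-1)^if(x_1,\ldots,x_ix_{i+1},\ldots,x_{n+1})+(-1)^{n+1}f(x_1,\ldots,x_n),$$ and the cohomological dimension of $S$ is the largest integer $n$ such that $H^n(S,A)\neq 0$ for some $S$-module $A$ (and $\infty$ if there are arbitrarily large such $n$). -/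

import Mathlib

universe u

namespace EMCohomology

section Complex

variable {S : Type*} [Semigroup S] {A : Type*} [AddCommGroup A]

/-- The coboundary homomorphism `∂ⁿ : Cⁿ(S, A) → Cⁿ⁺¹(S, A)`, where `Cⁿ(S, A)` is the group of all
maps `Sⁿ → A` and `A` is a left `S`-module with action `ρ`
(a semigroup homomorphism from `S` to the additive endomorphisms of `A`).
The tuple `Fin.contractNth i.castSucc (· * ·) x` multiplies the adjacent entries
`x i` and `x (i + 1)` (entries counted from `0`). -/
def d (ρ : S →ₙ* AddMonoid.End A) (n : ℕ) :
    ((Fin n → S) → A) →+ ((Fin (n + 1) → S) → A) where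
  toFun f x :=
    ρ (x 0) (f fun i => x i.succ)
      + ∑ i : Fin n, (-1 : ℤ) ^ ((i : ℕ) + 1) • f (Fin.contractNth i.castSucc (· * ·) x)
      + (-1 : ℤ) ^ (n + 1) • f fun i => x i.castSucc
  map_zero' := by
    funext x
    simp
  map_add' f g := by
    funext x
    simp only [Pi.add_apply, map_add, smul_add, Finset.sum_add_distrib]
    abel

/-- The group `Zⁿ(S, A)` of cocycles. -/
def cocycles (ρ : S →ₙ* AddMonoid.End A) (n : ℕ) : AddSubgroup ((Fin n → S) → A) :=
  (d ρ n).ker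

/-- The group `Bⁿ(S, A)` of coboundaries (zero in degree `0`). -/
def coboundaries (ρ : S →ₙ* AddMonoid.End A) : (n : ℕ) → AddSubgroup ((Fin n → S) → A)
  | 0 => ⊥
  | n + 1 => (d ρ n).range

/-- The Eilenberg–MacLane cohomology group `Hⁿ(S, A) = Zⁿ(S, A) / Bⁿ(S, A)`. -/
abbrev H (ρ : S →ₙ* AddMonoid.End A) (n : ℕ) : Type _ :=
  cocycles ρ n ⧸ (coboundaries ρ n).addSubgroupOf (cocycles ρ n)

end Complex

/-- The cohomological dimension of a semigroup `S`: the largest `n` such that `Hⁿ(S, A) ≠ 0` for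
some `S`-module `A`, and `⊤` if there are arbitrarily large such `n`. -/
noncomputable def cohomologicalDimension (S : Type u) [Semigroup S] : ℕ∞ :=
  sSup {m : ℕ∞ | ∃ n : ℕ, m = n ∧
    ∃ (A : Type u) (_ : AddCommGroup A) (ρ : S →ₙ* AddMonoid.End A), Nontrivial (H ρ n)}

end EMCohomology

/-- A subsemigroup `I` of `S` is a two-sided ideal if it is nonempty and `SI ⊆ I`, `IS ⊆ I`.
(Every two-sided ideal of a semigroup is a subsemigroup.) -/
structure IsTwoSidedSemigroupIdeal {S : Type*} [Semigroup S] (I : Subsemigroup S) : Prop where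
  nonempty : (I : Set S).Nonempty
  mul_mem_left : ∀ s : S, ∀ x ∈ I, s * x ∈ I
  mul_mem_right : ∀ s : S, ∀ x ∈ I, x * s ∈ I

namespace FreeSemigroup

variable {α : Type*}

/-! Some generator `a` lies outside `I`. For a letter `b`, let `f(s, t)` be `s` in `ℤI` if `t`
begins with `b`, and `0` otherwise; this is a 2-cocycle. If `f = ∂h`, subtract the equations at `(s,
at)` and `(sa, t)`: `h(sat)` cancels, and neither `s·h(at)` nor `sa·h(t)` has a coefficient at `sa`,
since `a ∉ I` and `I` has no identity. What remains of `h` does not depend on `t`, whereas `f(sa,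
t)` depends on the first letter of `t`. -/

theorem mul_left_cancel_of_eq {s x y : FreeSemigroup α} (h : s * x = s * y) : x = y := by
  obtain ⟨x, xs⟩ := x
  obtain ⟨y, ys⟩ := y
  have h' := congrArg FreeSemigroup.tail h
  simpa using h'

theorem mul_ne_self (s x : FreeSemigroup α) : s * x ≠ s := by
  intro h
  have h' := congrArg FreeSemigroup.length h
  have hx : 0 < x.length := Nat.succ_pos _
  rw [FreeSemigroup.length_mul] at h'
  omega

/-- The letters generate the free semigroup. -/
theorem exists_of_notMem_of_ne_top {I : Subsemigroup (FreeSemigroup α)} (h : I ≠ ⊤) :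
    ∃ a : α, FreeSemigroup.of a ∉ I := by
  by_contra! hI
  refine h (eq_top_iff.2 fun w _ => ?_)
  induction w using FreeSemigroup.recOnMul with
  | ih1 a => exact hI a
  | ih2 a w _ hw => exact I.mul_mem (hI a) (hw trivial)

end FreeSemigroup

namespace EMCohomology

section LowDegree

variable {S : Type*} [Semigroup S] {A : Type*} [AddCommGroup A] (ρ : S →ₙ* AddMonoid.End A)

theorem d_one_apply (h : (Fin 1 → S) → A) (s t : S) :
    d ρ 1 h ![s, t] = ρ s (h ![t]) - h ![s * t] + h ![s] := by
  have e1 : (fun i : Fin 1 => (![s, t] : Fin 2 → S) i.succ) = ![t] := by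
    ext i; fin_cases i; rfl
  have e2 : Fin.contractNth (0 : Fin 1).castSucc (· * ·) (![s, t] : Fin 2 → S) = ![s * t] := by
    ext i; fin_cases i; rfl
  have e3 : (fun i : Fin 1 => (![s, t] : Fin 2 → S) i.castSucc) = ![s] := by
    ext i; fin_cases i; rfl
  simp only [d, AddMonoidHom.coe_mk, ZeroHom.coe_mk, Fin.sum_univ_one, e1, e2, e3]
  simp [sub_eq_add_neg]

theorem d_two_apply (f : (Fin 2 → S) → A) (x : Fin 3 → S) :
    d ρ 2 f x = ρ (x 0) (f ![x 1, x 2]) - f ![x 0 * x 1, x 2] + f ![x 0, x 1 * x 2]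
      - f ![x 0, x 1] := by
  have e1 : (fun i : Fin 2 => x i.succ) = ![x 1, x 2] := by
    ext i; fin_cases i <;> rfl
  have e2 : Fin.contractNth (0 : Fin 2).castSucc (· * ·) x = ![x 0 * x 1, x 2] := by
    ext i; fin_cases i <;> rfl
  have e3 : Fin.contractNth (1 : Fin 2).castSucc (· * ·) x = ![x 0, x 1 * x 2] := by
    ext i; fin_cases i <;> rfl
  have e4 : (fun i : Fin 2 => x i.castSucc) = ![x 0, x 1] := by
    ext i; fin_cases i <;> rfl
  simp only [d, AddMonoidHom.coe_mk, ZeroHom.coe_mk, Fin.sum_univ_two, e1, e2, e3, e4]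
  simp [sub_eq_add_neg]
  abel

theorem nontrivial_H_succ {n : ℕ} {f : (Fin (n + 1) → S) → A} (hf : d ρ (n + 1) f = 0)
    (hf' : ∀ h, d ρ n h ≠ f) : Nontrivial (H ρ (n + 1)) := by
  rw [QuotientAddGroup.nontrivial_iff]
  intro htop
  have hmem : (⟨f, hf⟩ : cocycles ρ (n + 1)) ∈
      (coboundaries ρ (n + 1)).addSubgroupOf (cocycles ρ (n + 1)) := htop ▸ trivial
  obtain ⟨h, hh⟩ := AddSubgroup.mem_addSubgroupOf.1 hmem
  exact hf' h hh

theorem le_cohomologicalDimension {S A : Type u} [Semigroup S] [AddCommGroup A]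
    (ρ : S →ₙ* AddMonoid.End A) (n : ℕ) [Nontrivial (H ρ n)] :
    (n : ℕ∞) ≤ cohomologicalDimension S :=
  le_sSup ⟨n, rfl, A, inferInstance, ρ, inferInstance⟩

end LowDegree

/-- The left regular module `ℤS` of a semigroup `S`. -/
noncomputable def leftRegular (S : Type*) [Semigroup S] : S →ₙ* AddMonoid.End (S →₀ ℤ) where
  toFun s := (Finsupp.mapDomain.addMonoidHom (s * ·) : (S →₀ ℤ) →+ (S →₀ ℤ))
  map_mul' s t := by
    refine Finsupp.addHom_ext fun x n => ?_
    change Finsupp.mapDomain _ _ = Finsupp.mapDomain _ (Finsupp.mapDomain _ _)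
    simp only [Finsupp.mapDomain_single, mul_assoc]

theorem leftRegular_apply {S : Type*} [Semigroup S] (s : S) (f : S →₀ ℤ) :
    leftRegular S s f = Finsupp.mapDomain (s * ·) f := rfl

/-- The cochain `(s, t) ↦ s` if `p t`, and `0` otherwise, with values in `ℤS`. -/
noncomputable def restrictedCochain {S : Type*} (p : S → Prop) [DecidablePred p] :
    (Fin 2 → S) → (S →₀ ℤ) :=
  fun x => if p (x 1) then Finsupp.single (x 0) 1 else 0

theorem restrictedCochain_apply {S : Type*} (p : S → Prop) [DecidablePred p] (s t : S) :
    restrictedCochain p ![s, t] = if p t then Finsupp.single s 1 else 0 := rfl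

/-- By `hp`, the four terms cancel in pairs: the first two are governed by `p (x 2)`, the last two
by `p (x 1)`. -/
theorem d_restrictedCochain {S : Type*} [Semigroup S] (p : S → Prop)
    [DecidablePred p] (hp : ∀ s t, p (s * t) ↔ p s) :
    d (leftRegular S) 2 (restrictedCochain p) = 0 := by
  funext x
  simp only [d_two_apply, restrictedCochain_apply, leftRegular_apply, hp, Pi.zero_apply]
  split_ifs <;> simp [Finsupp.mapDomain_single]

end EMCohomology

open EMCohomology in
theorem corollary5 {α : Type u} [Nontrivial α] (I : Subsemigroup (FreeSemigroup α))
    (hI : IsTwoSidedSemigroupIdeal I) (hproper : I ≠ ⊤) :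
    1 < EMCohomology.cohomologicalDimension I := by
  classical
  obtain ⟨a, ha⟩ := FreeSemigroup.exists_of_notMem_of_ne_top hproper
  obtain ⟨b, c, hbc⟩ := exists_pair_ne α
  obtain ⟨s, hs⟩ := hI.nonempty
  have hcocycle := d_restrictedCochain (S := I) (fun t => (t : FreeSemigroup α).head = b)
    (fun s t => by simp)
  have : Nontrivial (H (leftRegular I) 2) := by
    refine nontrivial_H_succ _ hcocycle fun h hh => ?_
    let σ : I := ⟨s, hs⟩
    let σa : I := ⟨s * FreeSemigroup.of a, hI.mul_mem_right _ _ hs⟩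
    -- Compare the coefficients of `s * a` in the coboundary at `(s, a * t)` and `(s * a, t)`.
    have key (t : I) : h ![σ] σa - h ![σa] σa =
        (if a = b then Finsupp.single σ (1 : ℤ) σa else 0)
          - if (t : FreeSemigroup α).head = b then 1 else 0 := by
      let at' : I := ⟨FreeSemigroup.of a * t, hI.mul_mem_left _ _ t.2⟩
      have e : σ * at' = σa * t := Subtype.ext (mul_assoc _ _ _).symm
      have h1 := DFunLike.congr_fun (congrFun hh ![σ, at']) σa
      have h2 := DFunLike.congr_fun (congrFun hh ![σa, t]) σa
      -- A preimage `x ∈ I` would satisfy `s * x = s * a`, forcing `x = a ∉ I`.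
      have z1 : Finsupp.mapDomain (σ * ·) (h ![at']) σa = 0 := by
        refine Finsupp.mapDomain_of_notMem_range _ _ ?_
        rintro ⟨x, hx⟩
        exact ha (FreeSemigroup.mul_left_cancel_of_eq (congrArg Subtype.val hx) ▸ x.2)
      have z2 : Finsupp.mapDomain (σa * ·) (h ![t]) σa = 0 := by
        refine Finsupp.mapDomain_of_notMem_range _ _ ?_
        rintro ⟨x, hx⟩
        exact FreeSemigroup.mul_ne_self _ _ (congrArg Subtype.val hx)
      have hd : (at' : FreeSemigroup α).head = a := rfl
      rw [d_one_apply, leftRegular_apply, restrictedCochain_apply] at h1 h2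
      simp only [Finsupp.add_apply, Finsupp.sub_apply, z1, z2, e, hd] at h1 h2
      split_ifs at h1 h2 ⊢ <;> simp only [Finsupp.single_eq_same, Finsupp.zero_apply] at h1 h2 <;>
        linarith
    -- Two elements of `I` with different first letters; the unevaluated `a = b` term is the same
    -- for both and drops out.
    have hb := key ⟨FreeSemigroup.of b * s, hI.mul_mem_left _ _ hs⟩
    have hc := key ⟨FreeSemigroup.of c * s, hI.mul_mem_left _ _ hs⟩
    have := hb.symm.trans hc
    simp [hbc.symm] at this
  exact lt_of_lt_of_le (by norm_num) (le_cohomologicalDimension (leftRegular I) 2)
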